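/- Let $G$ be a digraph without self-loops on $n\ge 1$ agents. Put $a_{ij}=1$ if $(i,j)$ is an edge (agent $i$ receives information from agent $j$) and $a_{ij}=0$ otherwise, $d_i=\sum_j a_{ij}$, and $L=\mathrm{diag}(d_1,\dots,d_n)-(a_{ij})$. A directed path from $j$ to $i$ is a chain of edges $(i,v_1),(v_1,v_2),\dots,(v_l,j)$. Suppose that $G$ contains a spanning tree, i.e. some node has directed paths to all others. Number the strongly connected components of $G$ by $1,\dots,K$ so that $L$ is block upper triangular, with blocks $L^{k,p}$ ($L^{k,p}=0$ for $p<k$); write $v_i^k$, $1\le i\le n_k$, for the agents of component $k$, and $x_i^k,\hat x_i^k,d_i^k,\delta_i^k,\sigma_i^k$ for the corresponding quantities. Let $\tilde L^{k,k}=(\tilde l^{k,k}_{ij})$ be obtained from $L^{k,k}$ by changing the diagonal entries so that all row sums are zero. Let $h>0$ be any sampling period, and let $0<\delta_i<\frac12$ and $\sigma_i$ be constants. Consider the system, for $t\ge 0$, $$\dot x_i(t)=u_i(t),\qquad u_i(t)=-\frac{\delta_i}{h d_i}\sum_{j} a_{ij}\,[\hat x_i(t)-\hat x_j(t)]\ \text{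 if } d_i>0,\qquad u_i(t)=0\ \text{ if } d_i=0,$$ with arbitrary initial state, where $x_i$ is continuous, $\dot x_i$ is the right derivative, and $\hat x_i(t)$ is the value of $x_i$ at the latest event instant of agent $i$ not exceeding $t$. All event instants lie in $\{0,h,2h,\dots\}$, and $0$ is one for every agent. For an agent $v_i^k$ with $d_i^k>0$ and $m\ge 0$, $(m+1)h$ is an event instant if and only if $$\big[x_i^k((m+1)h)-\hat x_i^k(mh)\big]^2-\frac{\sigma_i^k}{4d_i^k}\big(\hat q_i^k(mh)+\hat q_i^{k,K}(mh)\big)>0,$$ where $$\hat q_i^k=-\sum_{j=1}^{n_k}\tilde l^{k,k}_{ij}(\hat x_i^k-\hat x_j^k)^2,\qquad \hat q_i^{k,K}=-\sum_{p=k+1}^{K}\sum_{j=1}^{n_p} l^{k,p}_{ij}(\hat x_i^k-\hat x_j^p)^2 .$$ Suppose that $0<\sigma_i^k<1-2\delta_i^k$ for all $i,k$. Then there is exactly one $\xi=(\xi_1,\dots,\xi_{n_K})$ with $\xi^T\tilde L^{K,K}=0$ and $\sum_i\xi_i=1$. Put $$\mu_i=\frac{(\delta_i^K)^{-1}d_i^K\xi_i}{\sum_{j=1}^{n_K}(\delta_j^K)^{-1}d_j^K\xi_j}\quad\text{if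 } n_K\ge 2,\qquad \mu_1=1\quad\text{if } n_K=1 .$$ Then $\mu_i>0$, $\sum_i\mu_i=1$, and every solution reaches consensus: for every agent $v$, $$\lim_{t\to\infty}x_v(t)=c=\sum_{i=1}^{n_K}\mu_i\,x_i^K(0).$$ -/

import Mathlib

open Filter Topology

namespace EventConsensus

noncomputable section

/-- The adjacency matrix `A = [a i j]`: `a i j = 1` if `(i, j)` is an edge, i.e. if agent `j` is a
neighbour of agent `i` (agent `i` receives the information of agent `j`), and `a i j = 0`
otherwise. -/
def adjMatrix {V : Type*} (G : Digraph V) [DecidableRel G.Adj] : Matrix V V ℝ :=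
  Matrix.of fun i j => if G.Adj i j then 1 else 0

/-- The in-degree `d i = ∑ j, a i j`. -/
def inDegree {V : Type*} [Fintype V] (G : Digraph V) [DecidableRel G.Adj] (i : V) : ℝ :=
  ∑ j, adjMatrix G i j

/-- The Laplacian matrix `L = D - A`. -/
def laplacian {V : Type*} [Fintype V] [DecidableEq V] (G : Digraph V) [DecidableRel G.Adj] :
    Matrix V V ℝ :=
  Matrix.diagonal (inDegree G) - adjMatrix G

/-- There is a directed path (possibly empty) from `j` to `i`. As `(a, b)` is an edge when `a`
receives the information of `b`, such a path has the form `(i, v₁), (v₁, v₂), …, (vₗ, j)`. -/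
def HasPath {V : Type*} (G : Digraph V) (j i : V) : Prop :=
  Relation.ReflTransGen G.Adj i j

/-- The digraph contains a spanning tree: some root node has a directed path to every node. -/
def HasSpanningTree {V : Type*} (G : Digraph V) : Prop :=
  ∃ r : V, ∀ i : V, HasPath G r i

/-- A Perron-Frobenius (block upper triangular) form of the Laplacian, with `K` diagonal blocks:
the strongly connected components of `G` are numbered by `1, …, K` in such a way that
`L^{k,p} = 0` for `p < k`. Here `blk i` is the number of the component that contains `i`. -/
structure PerronFrobeniusForm {V : Type*} [Fintype V] [DecidableEq V] (G : Digraph V)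
    [DecidableRel G.Adj] (K : ℕ) where
  /-- the number of the component of an agent -/
  blk : V → ℕ
  range_blk : Set.range blk = Set.Icc 1 K
  blk_eq_iff : ∀ i j, blk i = blk j ↔ HasPath G i j ∧ HasPath G j i
  upper_triangular : ∀ i j, blk j < blk i → laplacian G i j = 0

/-- Every finite digraph admits a Perron-Frobenius form. -/
theorem exists_perronFrobeniusForm {V : Type*} [Fintype V] [DecidableEq V] (G : Digraph V)
    [DecidableRel G.Adj] : ∃ K : ℕ, Nonempty (PerronFrobeniusForm G K) := by
  classical
  let pre : Preorder V :=
    { le := fun i j => Relation.ReflTransGen G.Adj i j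
      le_refl := fun _ => Relation.ReflTransGen.refl
      le_trans := fun _ _ _ hab hbc => Relation.ReflTransGen.trans hab hbc }
  let Q := Antisymmetrization V (· ≤ ·)
  let q : V → Q := toAntisymmetrization (· ≤ ·)
  let F : Fintype (LinearExtension Q) := Fintype.ofSurjective (α := V) (fun v => toLinearExtension (q v))
    (fun y => by
      induction y using Quotient.inductionOn with
      | h v => exact ⟨v, rfl⟩)
  let e : LinearExtension Q ≃o Fin (Fintype.card (LinearExtension Q)) :=
    (Fintype.orderIsoFinOfCardEq _ rfl).symm
  refine ⟨Fintype.card (LinearExtension Q),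
    ⟨⟨fun v => (e (toLinearExtension (q v)) : ℕ) + 1, ?_, ?_, ?_⟩⟩⟩
  · ext m
    constructor
    · rintro ⟨v, rfl⟩
      exact ⟨Nat.succ_pos _, (e (toLinearExtension (q v))).2⟩
    · rintro ⟨h1, h2⟩
      obtain ⟨y, hy⟩ := e.surjective ⟨m - 1, by omega⟩
      induction y using Quotient.inductionOn with
      | h v =>
        refine ⟨v, ?_⟩
        have : (e (toLinearExtension (q v)) : ℕ) = m - 1 := congrArg Fin.val hy
        show (e (toLinearExtension (q v)) : ℕ) + 1 = m
        omega
  · intro i j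
    constructor
    · intro h
      have h1 : e (toLinearExtension (q i)) = e (toLinearExtension (q j)) :=
        Fin.ext (Nat.succ_injective h)
      have h2 : q i = q j := e.injective h1
      have h3 : AntisymmRel (· ≤ ·) i j := Quotient.exact h2
      exact ⟨h3.2, h3.1⟩
    · rintro ⟨h1, h2⟩
      have h3 : q i = q j := Quotient.sound (show AntisymmRel (· ≤ ·) i j from ⟨h2, h1⟩)
      simp only [h3]
  · intro i j hlt
    have hne : i ≠ j := by
      rintro rfl
      exact lt_irrefl _ hlt
    have hadj : ¬ G.Adj i j := by
      intro hadj
      have h1 : q i ≤ q j := by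
        show i ≤ j
        exact Relation.ReflTransGen.single hadj
      have h2 : e (toLinearExtension (q i)) ≤ e (toLinearExtension (q j)) :=
        e.monotone (toLinearExtension.monotone h1)
      have h3 : (e (toLinearExtension (q i)) : ℕ) ≤ e (toLinearExtension (q j)) := h2
      exact absurd hlt (by
        show ¬ ((e (toLinearExtension (q j)) : ℕ) + 1 < (e (toLinearExtension (q i)) : ℕ) + 1)
        omega)
    simp [laplacian, adjMatrix, hne, hadj]

namespace PerronFrobeniusForm

/-- The agents of the `k`-th strongly connected component. -/
abbrev Block {V : Type*} [Fintype V] [DecidableEq V] {G : Digraph V} [DecidableRel G.Adj] {K : ℕ}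
    (P : PerronFrobeniusForm G K) (k : ℕ) : Type _ :=
  {i : V // P.blk i = k}

/-- The auxiliary matrix `L̃^{k,k}`: the off-diagonal entries of `L^{k,k}`, with the diagonal
changed so that all row sums are zero. -/
def auxLaplacian {V : Type*} [Fintype V] [DecidableEq V] {G : Digraph V} [DecidableRel G.Adj]
    {K : ℕ} (P : PerronFrobeniusForm G K) (k : ℕ) : Matrix (P.Block k) (P.Block k) ℝ :=
  Matrix.of fun i j =>
    if i = j then -∑ p ∈ Finset.univ.erase i, laplacian G i.1 p.1 else laplacian G i.1 j.1

/-- `q̂_i^k = -∑_j l̃^{k,k}_{ij} (x̂_i^k - x̂_j^k)^2`, the sum over the agents of the component `k`. -/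
def qInner {V : Type*} [Fintype V] [DecidableEq V] {G : Digraph V} [DecidableRel G.Adj] {K : ℕ}
    (P : PerronFrobeniusForm G K) (k : ℕ) (i : P.Block k) (y : V → ℝ) : ℝ :=
  -∑ j : P.Block k, P.auxLaplacian k i j * (y i.1 - y j.1) ^ 2

/-- `q̂_i^{k,K} = -∑_{p=k+1}^K ∑_j l^{k,p}_{ij} (x̂_i^k - x̂_j^p)^2`, which is zero for `k = K`. -/
def qOuter {V : Type*} [Fintype V] [DecidableEq V] {G : Digraph V} [DecidableRel G.Adj] {K : ℕ}
    (P : PerronFrobeniusForm G K) (k : ℕ) (i : P.Block k) (y : V → ℝ) : ℝ :=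
  -∑ p ∈ Finset.Icc (k + 1) K, ∑ j : P.Block p, laplacian G i.1 j.1 * (y i.1 - y j.1) ^ 2

/-- `ξ` is a left eigenvector of `L̃^{K,K}` for the eigenvalue zero with `∑ i, ξ i = 1`. -/
def IsNormalizedLeftEigenvector {V : Type*} [Fintype V] [DecidableEq V] {G : Digraph V}
    [DecidableRel G.Adj] {K : ℕ} (P : PerronFrobeniusForm G K) (ξ : P.Block K → ℝ) : Prop :=
  Matrix.vecMul ξ (P.auxLaplacian K) = 0 ∧ ∑ i, ξ i = 1

/-- The weights `μ_i^K = δ_i⁻¹ d_i ξ_i / ∑_j δ_j⁻¹ d_j ξ_j` on the last (root) component. If that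
component is a single agent, then its in-degree is zero, and its weight is `1`. -/
def rootWeight {V : Type*} [Fintype V] [DecidableEq V] {G : Digraph V} [DecidableRel G.Adj] {K : ℕ}
    (P : PerronFrobeniusForm G K) (δ : V → ℝ) (ξ : P.Block K → ℝ) (i : P.Block K) : ℝ :=
  if Fintype.card (P.Block K) = 1 then 1
  else (δ i.1)⁻¹ * inDegree G i.1 * ξ i / ∑ j : P.Block K, (δ j.1)⁻¹ * inDegree G j.1 * ξ j

end PerronFrobeniusForm

/-- The control input without delay,
`u_i = -(δ_i / (h d_i)) ∑_j a_{ij} (x̂_i - x̂_j)`, and `u_i = 0` if agent `i` has no neighbours;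
`y` is the vector of the current values `x̂_j`. -/
def control {V : Type*} [Fintype V] (G : Digraph V) [DecidableRel G.Adj] (h : ℝ) (δ : V → ℝ)
    (y : V → ℝ) (i : V) : ℝ :=
  if inDegree G i = 0 then 0
  else -(δ i / (h * inDegree G i)) * ∑ j, adjMatrix G i j * (y i - y j)

/-- `x` (states), `xh` (the held states `x̂`) and `T` (sets of event instants) form a trajectory on
`[0, ∞)` of the closed loop with sampling period `h` and no delay. -/
structure IsClosedLoop {V : Type*} [Fintype V] [DecidableEq V] {G : Digraph V}
    [DecidableRel G.Adj] {K : ℕ} (P : PerronFrobeniusForm G K) (h : ℝ) (δ σ : V → ℝ)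
    (x xh : V → ℝ → ℝ) (T : V → Set ℝ) : Prop where
  /-- the first event instant of every agent is `0` -/
  zero_mem : ∀ i, 0 ∈ T i
  /-- events happen only at sampling instants `0, h, 2h, …` -/
  sampled : ∀ i, ∀ s ∈ T i, ∃ m : ℕ, s = m * h
  /-- `x̂_i` keeps the value of `x_i` at the latest event instant -/
  hold : ∀ i, ∀ s ∈ T i, ∀ t, s ≤ t → (∀ r ∈ T i, ¬ (s < r ∧ r ≤ t)) → xh i t = x i s
  /-- at the sampling instant `(m+1)h` an event of agent `i` happens exactly if the
  event-triggered condition holds there, where the error is `x_i((m+1)h) - x̂_i(mh)`, as the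
  judgement precedes the update; no condition is imposed on an agent without neighbours -/
  trigger : ∀ (k : ℕ) (i : P.Block k), inDegree G i.1 ≠ 0 → ∀ m : ℕ,
    (((m : ℝ) + 1) * h ∈ T i.1 ↔
      (x i.1 (((m : ℝ) + 1) * h) - xh i.1 (m * h)) ^ 2 -
        σ i.1 * (1 / (4 * inDegree G i.1)) *
          (P.qInner k i (fun j => xh j (m * h)) + P.qOuter k i (fun j => xh j (m * h))) > 0)
  continuous : ∀ i, ContinuousOn (x i) (Set.Ici 0)
  /-- `ẋ_i(t) = u_i(t)`; the piecewise constant input jumps at sampling instants, so that the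
  derivative is the right derivative -/
  dynamics : ∀ i, ∀ t, 0 ≤ t →
    HasDerivWithinAt (x i) (control G h δ (fun j => xh j t) i) (Set.Ici t) t

end

end EventConsensus

/-!
At the sampling instants the loop is the recursion
`x_i(m+1) = x_i(m) - (δ_i / d_i) ∑_j a_ij (y_i(m) - y_j(m))`, where `y` are the held values, and the
trigger guarantees `4 d_i (x_i - y_i)² ≤ σ_i q_i` one step later, where
`q_i = ∑_j a_ij (y_i - y_j)²` (`IsClosedLoop.error_le`).

The core is an energy estimate (`summable_disagreement`). For positive weights `ξ` on a set `S` of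
agents, the energy `∑_S ξ_i (d_i/δ_i (x_i - c)² + 2d_i/√σ_i (x_i - y_i)²)` decreases in each step by
`∑_S ξ_i (1 - δ_i - √σ_i) q_i`, up to the residual
`∑_S ξ_i ∑_j a_ij ((y_j - c)² - (y_i - c)²)`. As `√σ_i < √(1 - 2δ_i) ≤ 1 - δ_i`, a residual bounded
by a summable sequence makes every `q_i` summable in time.

* On the last component the left null vector `ξ` of its Laplacian is positive and unique up to
  scaling (a Perron–Frobenius argument: `|ξ|` is again a left null vector) and makes the residual
  vanish. By strong connectivity the differences `y_i - y_j` and the errors `x_i - y_i` are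
  square-summable. As `∑ μ_i x_i` is invariant, so are the deviations `y_i - c`.
* On the other agents no left null vector is positive. After adding edges from the last component to
  all other agents the graph is strongly connected, and its positive left null vector has a residual
  at most `C ∑ (y_j - c)²` over the last component, which is summable by the first part.

Following a path to the last component, every `y_i - c`, and with it every `x_i - c`, is
square-summable along the sampling instants. Between these the state is affine in time, so it
converges as `t → ∞`.
-/

open Filter Topology

namespace EventConsensus

/-! ### Balanced weights of a nonnegative matrix -/

section Balanced

variable {W : Type*} [Fintype W] {A : Matrix W W ℝ} {ξ : W → ℝ}

/-- The weights `ξ` are balanced for the nonnegative matrix `A` if at every node the weighted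
inflow equals the weighted outflow. Equivalently, `ξ` is a left null vector of the Laplacian
`diag (∑ k, A j k) - A`. -/
def IsBalanced (A : Matrix W W ℝ) (ξ : W → ℝ) : Prop :=
  ∀ j, ∑ i, ξ i * A i j = ξ j * ∑ k, A j k

/-- Irreducibility of the pattern of positive entries of `A`. -/
def IsStronglyConnected (A : Matrix W W ℝ) : Prop :=
  ∀ i j, Relation.ReflTransGen (fun i j => 0 < A i j) i j

theorem isBalanced_iff_vecMul_eq_zero [DecidableEq W] :
    IsBalanced A ξ ↔
      Matrix.vecMul ξ (Matrix.diagonal (fun i => ∑ k, A i k) - A) = 0 := by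
  rw [Matrix.vecMul_sub, sub_eq_zero, funext_iff]
  refine forall_congr' fun j => ?_
  rw [Matrix.vecMul_diagonal]
  exact eq_comm

theorem IsBalanced.add {η : W → ℝ} (hξ : IsBalanced A ξ) (hη : IsBalanced A η) :
    IsBalanced A (fun i => ξ i + η i) := by
  intro j
  simp only [add_mul, Finset.sum_add_distrib, hξ j, hη j]

theorem IsBalanced.const_mul (hξ : IsBalanced A ξ) (c : ℝ) :
    IsBalanced A (fun i => c * ξ i) := by
  intro j
  simp only [mul_assoc, ← Finset.mul_sum, hξ j]

/-- Balanced weights annihilate every weighted sum of differences along the edges. -/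
theorem IsBalanced.sum_mul_sum_sub (hξ : IsBalanced A ξ) (g : W → ℝ) :
    ∑ i, ξ i * ∑ j, A i j * (g j - g i) = 0 := by
  have h1 : ∑ i, ξ i * ∑ j, A i j * g j = ∑ j, (∑ i, ξ i * A i j) * g j := by
    simp only [Finset.mul_sum, Finset.sum_mul]
    rw [Finset.sum_comm]
    simp only [mul_assoc]
  have h2 : ∑ i, ξ i * ∑ j, A i j * (g j - g i) =
      ∑ i, ξ i * ∑ j, A i j * g j - ∑ i, (ξ i * ∑ j, A i j) * g i := by
    rw [← Finset.sum_sub_distrib]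
    refine Finset.sum_congr rfl fun i _ => ?_
    simp only [mul_sub, Finset.sum_sub_distrib, ← Finset.sum_mul]
    ring
  rw [h2, h1, ← Finset.sum_sub_distrib]
  exact Finset.sum_eq_zero fun j _ => by rw [hξ j, sub_self]

/-- In `|ξ j| ∑ k, A j k ≤ ∑ i, |ξ i| A i j` the sums over `j` of both sides agree, so that
equality holds at every node. -/
theorem IsBalanced.abs (hA : ∀ i j, 0 ≤ A i j) (hξ : IsBalanced A ξ) :
    IsBalanced A (fun i => |ξ i|) := by
  have hle : ∀ j ∈ Finset.univ, |ξ j| * ∑ k, A j k ≤ ∑ i, |ξ i| * A i j := by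
    intro j _
    calc |ξ j| * ∑ k, A j k = |∑ i, ξ i * A i j| := by
          rw [hξ j, abs_mul, abs_of_nonneg (Finset.sum_nonneg fun k _ => hA j k)]
      _ ≤ ∑ i, |ξ i * A i j| := Finset.abs_sum_le_sum_abs _ _
      _ = ∑ i, |ξ i| * A i j := by simp only [abs_mul, abs_of_nonneg (hA _ j)]
  have hsum : ∑ j, |ξ j| * ∑ k, A j k = ∑ j, ∑ i, |ξ i| * A i j := by
    rw [Finset.sum_comm]
    simp only [Finset.mul_sum]
  intro j
  exact ((Finset.sum_eq_sum_iff_of_le hle).1 hsum j (Finset.mem_univ j)).symm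

theorem IsBalanced.eq_zero_of_nonneg (hA : ∀ i j, 0 ≤ A i j) (hirr : IsStronglyConnected A)
    (hξ : IsBalanced A ξ) (h0 : ∀ i, 0 ≤ ξ i) {j : W} (hj : ξ j = 0) (i : W) : ξ i = 0 := by
  induction hirr i j using Relation.ReflTransGen.head_induction_on with
  | refl => exact hj
  | @head a b hab _ ih =>
    have hsum : ∑ i, ξ i * A i b = 0 := by rw [hξ b, ih, zero_mul]
    have := (Finset.sum_eq_zero_iff_of_nonneg fun i _ => mul_nonneg (h0 i) (hA i b)).1 hsum a
      (Finset.mem_univ a)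
    exact (mul_eq_zero.1 this).resolve_right hab.ne'

/-- Balanced weights of an irreducible matrix have a strict sign: `|ξ| + ξ` is balanced and
nonnegative, hence zero or positive everywhere. -/
theorem IsBalanced.nonpos_or_pos (hA : ∀ i j, 0 ≤ A i j) (hirr : IsStronglyConnected A)
    (hξ : IsBalanced A ξ) : (∀ i, ξ i ≤ 0) ∨ ∀ i, 0 < ξ i := by
  have hb := (hξ.abs hA).add hξ
  have h0 : ∀ i, 0 ≤ |ξ i| + ξ i := fun i => by linarith [neg_abs_le (ξ i)]
  by_cases hz : ∃ j, |ξ j| + ξ j = 0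
  · obtain ⟨j, hj⟩ := hz
    left
    intro i
    have := hb.eq_zero_of_nonneg hA hirr h0 hj i
    linarith [abs_nonneg (ξ i)]
  · right
    intro i
    by_contra hi
    exact hz ⟨i, by rw [abs_of_nonpos (not_lt.1 hi)]; ring⟩

theorem IsBalanced.pos_of_sum_pos (hA : ∀ i j, 0 ≤ A i j) (hirr : IsStronglyConnected A)
    (hξ : IsBalanced A ξ) (hs : 0 < ∑ i, ξ i) (i : W) : 0 < ξ i := by
  rcases hξ.nonpos_or_pos hA hirr with h | h
  · exact absurd hs (not_lt.2 (Finset.sum_nonpos fun i _ => h i))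
  · exact h i

theorem IsBalanced.eq_zero_of_sum_eq_zero (hA : ∀ i j, 0 ≤ A i j)
    (hirr : IsStronglyConnected A) (hξ : IsBalanced A ξ) (hs : ∑ i, ξ i = 0) (i : W) :
    ξ i = 0 := by
  rcases hξ.nonpos_or_pos hA hirr with h | h
  · exact (Finset.sum_eq_zero_iff_of_nonpos fun i _ => h i).1 hs i (Finset.mem_univ i)
  · exact (Finset.sum_eq_zero_iff_of_nonneg fun i _ => (h i).le).1 hs i (Finset.mem_univ i)

theorem existsUnique_isBalanced [Nonempty W] (hA : ∀ i j, 0 ≤ A i j)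
    (hirr : IsStronglyConnected A) : ∃! ξ : W → ℝ, IsBalanced A ξ ∧ ∑ i, ξ i = 1 := by
  classical
  -- The Laplacian kills the constant vector, so it is singular and has a left null vector.
  have hdet : (Matrix.diagonal (fun i => ∑ k, A i k) - A).det = 0 := by
    refine Matrix.exists_mulVec_eq_zero_iff.1 ⟨fun _ => 1, ?_, ?_⟩
    · exact fun h => one_ne_zero (congrFun h (Classical.arbitrary W))
    · ext i
      simp [Matrix.mulVec, dotProduct, Matrix.diagonal_apply]
  obtain ⟨η, hη0, hη⟩ := Matrix.exists_vecMul_eq_zero_iff.2 hdet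
  have hb : IsBalanced A η := isBalanced_iff_vecMul_eq_zero.2 hη
  have hs : ∑ i, η i ≠ 0 := fun hs => hη0 (funext (hb.eq_zero_of_sum_eq_zero hA hirr hs))
  refine ⟨_, ⟨hb.const_mul (∑ i, η i)⁻¹, ?_⟩, ?_⟩
  · rw [← Finset.mul_sum, inv_mul_cancel₀ hs]
  · rintro ξ ⟨hξ, hξ1⟩
    have hd := hξ.add ((hb.const_mul (∑ i, η i)⁻¹).const_mul (-1))
    have hd0 := hd.eq_zero_of_sum_eq_zero hA hirr (by
      simp only [Finset.sum_add_distrib, ← Finset.mul_sum, hξ1, inv_mul_cancel₀ hs]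
      norm_num)
    ext i
    have := hd0 i
    linarith

end Balanced

/-! ### Square-summable sequences -/

/-- The sequence `f` is square-summable. -/
def SqSummable (f : ℕ → ℝ) : Prop := Summable fun m => f m ^ 2

theorem SqSummable.add {f g : ℕ → ℝ} (hf : SqSummable f) (hg : SqSummable g) :
    SqSummable (fun m => f m + g m) := by
  refine Summable.of_nonneg_of_le (fun m => sq_nonneg _) (fun m => ?_)
    ((Summable.mul_left 2 hf).add (Summable.mul_left 2 hg))
  nlinarith [sq_nonneg (f m - g m)]

theorem SqSummable.const_mul {f : ℕ → ℝ} (hf : SqSummable f) (c : ℝ) :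
    SqSummable (fun m => c * f m) := by
  simpa only [SqSummable, mul_pow] using Summable.mul_left (c ^ 2) hf

theorem SqSummable.sum {ι : Type*} (s : Finset ι) {f : ι → ℕ → ℝ}
    (hf : ∀ i ∈ s, SqSummable (f i)) : SqSummable (fun m => ∑ i ∈ s, f i m) := by
  classical
  induction s using Finset.induction_on with
  | empty => simp [SqSummable]
  | insert a s ha ih =>
    simp only [Finset.sum_insert ha]
    exact (hf a (Finset.mem_insert_self a s)).add
      (ih fun i hi => hf i (Finset.mem_insert_of_mem hi))

theorem SqSummable.tendsto_zero {f : ℕ → ℝ} (hf : SqSummable f) : Tendsto f atTop (𝓝 0) := by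
  have h := (Real.continuous_sqrt.tendsto 0).comp (Summable.tendsto_atTop_zero hf)
  rw [Real.sqrt_zero] at h
  rw [tendsto_zero_iff_abs_tendsto_zero]
  refine h.congr fun m => ?_
  simp [Real.sqrt_sq_eq_abs]

/-! ### Dissipation of the weighted energy -/

/-- `∑ j, A i j (y i - y j)²`, the disagreement of node `i` with its neighbours. -/
def disagreement {V : Type*} [Fintype V] (A : Matrix V V ℝ) (y : V → ℝ) (i : V) : ℝ :=
  ∑ j, A i j * (y i - y j) ^ 2

theorem disagreement_nonneg {V : Type*} [Fintype V] {A : Matrix V V ℝ} (hA : ∀ i j, 0 ≤ A i j)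
    (y : V → ℝ) (i : V) : 0 ≤ disagreement A y i :=
  Finset.sum_nonneg fun j _ => mul_nonneg (hA i j) (sq_nonneg _)

theorem sq_sum_le_mul_disagreement {V : Type*} [Fintype V] {A : Matrix V V ℝ}
    (hA : ∀ i j, 0 ≤ A i j) (y : V → ℝ) (i : V) :
    (∑ j, A i j * (y i - y j)) ^ 2 ≤ (∑ j, A i j) * disagreement A y i :=
  Finset.sum_sq_le_sum_mul_sum_of_sq_le_mul _ (fun j _ => hA i j)
    (fun j _ => mul_nonneg (hA i j) (sq_nonneg _)) fun j _ => (by ring : _ = _).le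

/-- A nonnegative energy that drops by `g` up to a summable error forces `g` to be summable. -/
theorem summable_of_energy_decrease {U f g : ℕ → ℝ} (hU : ∀ m, 0 ≤ U m) (hf : Summable f)
    (hg : ∀ m, 0 ≤ g m) (hstep : ∀ m, U (m + 1) ≤ U m - g m + f m) : Summable g := by
  obtain ⟨C, hC⟩ := hf.tendsto_sum_tsum_nat.bddAbove_range
  refine summable_of_sum_range_le (c := U 0 + C) hg fun n => ?_
  have key : ∀ n, U n + ∑ m ∈ Finset.range n, g m ≤ U 0 + ∑ m ∈ Finset.range n, f m := by
    intro n
    induction n with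
    | zero => simp
    | succ n ih =>
      rw [Finset.sum_range_succ, Finset.sum_range_succ]
      linarith [hstep n]
  have := hC ⟨n, rfl⟩
  simp only at this
  linarith [key n, hU n]

/-- The sampled agents `x`, driven by the held values `y`, dissipate the energy
`∑ ξ d/δ (x - c)² + ∑ ξ 2d/√σ (x - y)²` over the set `S` of agents, provided that the term
`∑ ξ ∑ A i j ((y j - c)² - (y i - c)²)`, by which `ξ` fails to be balanced on `S`, is at most a
summable sequence. The rate is `1 - δ - √σ`, which is positive since
`σ < 1 - 2 δ ≤ (1 - δ)²`. -/
theorem summable_disagreement {V : Type*} [Fintype V] {A : Matrix V V ℝ}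
    (hA : ∀ i j, 0 ≤ A i j) (S : Finset V) (hd : ∀ i ∈ S, 0 < ∑ j, A i j)
    {δ σ ξ : V → ℝ} (hδ : ∀ i, 0 < δ i ∧ δ i < 1 / 2) (hσ : ∀ i, 0 < σ i ∧ σ i < 1 - 2 * δ i)
    (hξ : ∀ i ∈ S, 0 < ξ i) {x y : ℕ → V → ℝ}
    (hstep : ∀ m, ∀ i ∈ S,
      x (m + 1) i = x m i - δ i / (∑ j, A i j) * ∑ j, A i j * (y m i - y m j))
    (herr : ∀ m, ∀ i ∈ S,
      4 * (∑ j, A i j) * (x (m + 1) i - y (m + 1) i) ^ 2 ≤ σ i * disagreement A (y m) i)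
    (c : ℝ) {f : ℕ → ℝ} (hf : Summable f)
    (hres : ∀ m, ∑ i ∈ S, ξ i * ∑ j, A i j * ((y m j - c) ^ 2 - (y m i - c) ^ 2) ≤ f m) :
    ∀ i ∈ S, Summable fun m => disagreement A (y m) i := by
  have hτ : ∀ i, 0 < √(σ i) := fun i => Real.sqrt_pos.2 (hσ i).1
  have hττ : ∀ i, √(σ i) * √(σ i) = σ i := fun i => Real.mul_self_sqrt (hσ i).1.le
  have hrate : ∀ i, 0 < 1 - δ i - √(σ i) := by
    intro i
    have : √(σ i) < 1 - δ i := by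
      rw [Real.sqrt_lt' (by linarith [(hδ i).2])]
      nlinarith [(hσ i).2, sq_nonneg (δ i)]
    linarith
  have hq := fun m => disagreement_nonneg hA (y m)
  have hsummable : Summable fun m =>
      ∑ i ∈ S, ξ i * ((1 - δ i - √(σ i)) * disagreement A (y m) i) := by
    refine summable_of_energy_decrease
      (U := fun m => ∑ i ∈ S, ξ i * ((∑ j, A i j) / δ i * (x m i - c) ^ 2 +
        2 * (∑ j, A i j) / √(σ i) * (x m i - y m i) ^ 2)) (f := f) ?_ hf ?_ ?_
    · intro m
      refine Finset.sum_nonneg fun i hi => mul_nonneg (hξ i hi).le (add_nonneg ?_ ?_)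
      · exact mul_nonneg (div_nonneg (hd i hi).le (hδ i).1.le) (sq_nonneg _)
      · exact mul_nonneg (div_nonneg (by linarith [hd i hi]) (hτ i).le) (sq_nonneg _)
    · exact fun m => Finset.sum_nonneg fun i hi =>
        mul_nonneg (hξ i hi).le (mul_nonneg (hrate i).le (hq m i))
    · intro m
      refine le_trans ?_ (add_le_add_right (hres m) _)
      rw [← Finset.sum_sub_distrib, ← Finset.sum_add_distrib]
      refine Finset.sum_le_sum fun i hi => ?_
      rw [← mul_sub, ← mul_add]
      refine mul_le_mul_of_nonneg_left ?_ (hξ i hi).le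
      have hcs := sq_sum_le_mul_disagreement hA (y m) i
      have he := herr m i hi
      have hdi := hd i hi
      -- polarization: `2 (y i - c)(y i - y j) = (y i - y j)² + (y i - c)² - (y j - c)²`
      have hpol : ∑ j, A i j * ((y m j - c) ^ 2 - (y m i - c) ^ 2) =
          disagreement A (y m) i - 2 * (y m i - c) * ∑ j, A i j * (y m i - y m j) := by
        rw [disagreement, Finset.mul_sum, ← Finset.sum_sub_distrib]
        exact Finset.sum_congr rfl fun j _ => by ring
      rw [hpol, hstep m i hi]
      rw [hstep m i hi] at he
      set d := ∑ j, A i j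
      set s := ∑ j, A i j * (y m i - y m j)
      set q := disagreement A (y m) i
      set τ := √(σ i)
      have hδi := (hδ i).1
      have hτi : 0 < τ := hτ i
      have h1 : d / δ i * (x m i - δ i / d * s - c) ^ 2 =
          d / δ i * (x m i - c) ^ 2 - 2 * (x m i - c) * s + δ i * (s ^ 2 / d) := by
        field_simp
        ring
      have h2 : s ^ 2 / d ≤ q := by
        rw [div_le_iff₀ hdi]
        linarith
      have h3 : 2 * d / τ * (x m i - δ i / d * s - y (m + 1) i) ^ 2 ≤ τ / 2 * q := by
        rw [div_mul_eq_mul_div, div_le_iff₀ hτi]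
        have : τ / 2 * q * τ = σ i * q / 2 := by rw [← hττ i]; ring
        linarith
      have h4 : -2 * (x m i - y m i) * s ≤
          2 * d / τ * (x m i - y m i) ^ 2 + τ / 2 * (s ^ 2 / d) := by
        have : 0 ≤ (2 * d * (x m i - y m i) + τ * s) ^ 2 / (2 * d * τ) := by positivity
        have h5 : (2 * d * (x m i - y m i) + τ * s) ^ 2 / (2 * d * τ) =
            2 * d / τ * (x m i - y m i) ^ 2 + τ / 2 * (s ^ 2 / d) +
              2 * (x m i - y m i) * s := by
          field_simp
          ring
        linarith
      have h6 := mul_le_mul_of_nonneg_left h2 hδi.le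
      have h7 := mul_le_mul_of_nonneg_left h2 (half_pos hτi).le
      rw [h1]
      linarith
  intro i hi
  have hpos : 0 < ξ i * (1 - δ i - √(σ i)) := mul_pos (hξ i hi) (hrate i)
  refine (summable_mul_left_iff hpos.ne').1
    (Summable.of_nonneg_of_le (fun m => mul_nonneg hpos.le (hq m i)) (fun m => ?_) hsummable)
  rw [mul_assoc]
  exact Finset.single_le_sum
    (f := fun i => ξ i * ((1 - δ i - √(σ i)) * disagreement A (y m) i))
    (fun i hi => mul_nonneg (hξ i hi).le (mul_nonneg (hrate i).le (hq m i))) hi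

theorem sqSummable_sub_of_summable_disagreement {V : Type*} [Fintype V] {A : Matrix V V ℝ}
    (hA : ∀ i j, 0 ≤ A i j) {y : ℕ → V → ℝ} {i j : V} (hij : 0 < A i j)
    (hq : Summable fun m => disagreement A (y m) i) : SqSummable fun m => y m i - y m j := by
  refine (summable_mul_left_iff hij.ne').1
    (Summable.of_nonneg_of_le (fun m => mul_nonneg hij.le (sq_nonneg _)) (fun m => ?_) hq)
  exact Finset.single_le_sum (f := fun j => A i j * (y m i - y m j) ^ 2)
    (fun j _ => mul_nonneg (hA i j) (sq_nonneg _)) (Finset.mem_univ j)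

/-! ### The graph and its root component -/

section Graph

theorem adjMatrix_apply {V : Type*} {G : Digraph V} [DecidableRel G.Adj] (i j : V) :
    adjMatrix G i j = if G.Adj i j then 1 else 0 := rfl

theorem adjMatrix_nonneg {V : Type*} {G : Digraph V} [DecidableRel G.Adj] (i j : V) :
    0 ≤ adjMatrix G i j := by
  rw [adjMatrix_apply]; split_ifs <;> norm_num

theorem adjMatrix_pos_iff {V : Type*} {G : Digraph V} [DecidableRel G.Adj] {i j : V} :
    0 < adjMatrix G i j ↔ G.Adj i j := by
  rw [adjMatrix_apply]; split_ifs with h <;> simp [h]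

theorem adjMatrix_self {V : Type*} {G : Digraph V} [DecidableRel G.Adj]
    (hloop : ∀ i, ¬ G.Adj i i) (i : V) : adjMatrix G i i = 0 := by
  rw [adjMatrix_apply, if_neg (hloop i)]

variable {V : Type*} [Fintype V] {G : Digraph V} [DecidableRel G.Adj]

theorem inDegree_nonneg (i : V) : 0 ≤ inDegree G i :=
  Finset.sum_nonneg fun j _ => adjMatrix_nonneg i j

theorem inDegree_pos_of_adj {i j : V} (h : G.Adj i j) : 0 < inDegree G i :=
  Finset.sum_pos' (fun j _ => adjMatrix_nonneg i j)
    ⟨j, Finset.mem_univ j, adjMatrix_pos_iff.2 h⟩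

variable [DecidableEq V]

theorem laplacian_apply_of_ne {i j : V} (hij : i ≠ j) : laplacian G i j = -adjMatrix G i j := by
  simp [laplacian, hij]

namespace PerronFrobeniusForm

variable {K : ℕ} (P : PerronFrobeniusForm G K)

theorem adjMatrix_eq_zero {i j : V} (h : P.blk j < P.blk i) : adjMatrix G i j = 0 := by
  have hij : i ≠ j := by rintro rfl; exact lt_irrefl _ h
  have := P.upper_triangular i j h
  rwa [laplacian_apply_of_ne hij, neg_eq_zero] at this

theorem blk_le_of_adj {i j : V} (h : G.Adj i j) : P.blk i ≤ P.blk j := by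
  by_contra hlt
  have := P.adjMatrix_eq_zero (not_le.1 hlt)
  exact (adjMatrix_pos_iff.2 h).ne' this

theorem blk_le_of_hasPath {i j : V} (h : HasPath G j i) : P.blk i ≤ P.blk j := by
  induction h with
  | refl => exact le_rfl
  | tail _ hbc ih => exact ih.trans (P.blk_le_of_adj hbc)

theorem blk_le (i : V) : P.blk i ≤ K := by
  have : P.blk i ∈ Set.Icc 1 K := P.range_blk ▸ Set.mem_range_self i
  exact this.2

theorem one_le_blk (i : V) : 1 ≤ P.blk i := by
  have : P.blk i ∈ Set.Icc 1 K := P.range_blk ▸ Set.mem_range_self i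
  exact this.1

theorem exists_root (htree : HasSpanningTree G) :
    ∃ r : V, P.blk r = K ∧ ∀ i, HasPath G r i := by
  obtain ⟨r, hr⟩ := htree
  have hK : K ∈ Set.range P.blk := by
    rw [P.range_blk]
    exact ⟨(P.one_le_blk r).trans (P.blk_le r), le_rfl⟩
  obtain ⟨v, hv⟩ := hK
  exact ⟨r, le_antisymm (P.blk_le r) (hv.symm.le.trans (P.blk_le_of_hasPath (hr v))), hr⟩

/-- No edge leaves the last component, so that a path that starts there stays there. -/
theorem reflTransGen_block {i : V} (hi : P.blk i = K) {j : V} (hj : P.blk j = K)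
    (h : Relation.ReflTransGen G.Adj i j) :
    Relation.ReflTransGen (fun a b : P.Block K => G.Adj a.1 b.1) ⟨i, hi⟩ ⟨j, hj⟩ := by
  induction h with
  | refl => exact .refl
  | @tail b c hab hbc ih =>
    have hb : P.blk b = K :=
      le_antisymm (P.blk_le b) (hi.symm.le.trans (P.blk_le_of_hasPath hab))
    exact (ih hb).tail hbc

/-- The adjacency matrix of the last component. -/
def rootMatrix : Matrix (P.Block K) (P.Block K) ℝ :=
  Matrix.of fun i j => adjMatrix G i.1 j.1

theorem rootMatrix_apply (i j : P.Block K) : P.rootMatrix i j = adjMatrix G i.1 j.1 := rfl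

theorem isStronglyConnected_rootMatrix : IsStronglyConnected P.rootMatrix := by
  rintro ⟨i, hi⟩ ⟨j, hj⟩
  have h := P.reflTransGen_block hi hj ((P.blk_eq_iff i j).1 (hi.trans hj.symm)).2
  exact h.lift id fun a b hab => adjMatrix_pos_iff.2 hab

/-- An agent of the last component has all its neighbours there. -/
theorem sum_rootMatrix_mul (i : P.Block K) (g : V → ℝ) :
    ∑ j, P.rootMatrix i j * g j.1 = ∑ j, adjMatrix G i.1 j * g j := by
  have h : ∑ j : P.Block K, adjMatrix G i.1 j.1 * g j.1 =
      ∑ j ∈ Finset.univ.filter (fun j => P.blk j = K), adjMatrix G i.1 j * g j :=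
    (Finset.sum_subtype _ (by simp) (fun j => adjMatrix G i.1 j * g j)).symm
  refine h.trans (Finset.sum_subset (Finset.subset_univ _) fun j _ hj => ?_)
  have hjK : P.blk j ≠ K := by simpa using hj
  rw [P.adjMatrix_eq_zero (i.2.symm ▸ lt_of_le_of_ne (P.blk_le j) hjK), zero_mul]

theorem sum_rootMatrix (i : P.Block K) : ∑ j, P.rootMatrix i j = inDegree G i.1 := by
  simpa [inDegree] using P.sum_rootMatrix_mul i fun _ => 1

theorem disagreement_rootMatrix (y : V → ℝ) (i : P.Block K) :
    disagreement P.rootMatrix (fun j => y j.1) i = disagreement (adjMatrix G) y i.1 :=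
  P.sum_rootMatrix_mul i fun j => (y i.1 - y j) ^ 2

theorem inDegree_root_pos (hcard : Fintype.card (P.Block K) ≠ 1) (i : P.Block K) :
    0 < inDegree G i.1 := by
  have hpos : 0 < Fintype.card (P.Block K) := Fintype.card_pos_iff.2 ⟨i⟩
  obtain ⟨j, hj⟩ := Fintype.exists_ne_of_one_lt_card (by omega) i
  rcases (P.isStronglyConnected_rootMatrix i j).cases_head with h | ⟨b, hb, _⟩
  · exact absurd h.symm hj
  · exact inDegree_pos_of_adj (adjMatrix_pos_iff.1 hb)

theorem inDegree_root_eq_zero (hloop : ∀ i, ¬ G.Adj i i)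
    (hcard : Fintype.card (P.Block K) = 1) (i : P.Block K) : inDegree G i.1 = 0 := by
  have : Subsingleton (P.Block K) := Fintype.card_le_one_iff_subsingleton.1 hcard.le
  rw [← P.sum_rootMatrix]
  refine Finset.sum_eq_zero fun j _ => ?_
  rw [Subsingleton.elim j i, rootMatrix_apply, adjMatrix_self hloop]

theorem auxLaplacian_apply_of_ne {k : ℕ} {i j : P.Block k} (hij : i ≠ j) :
    P.auxLaplacian k i j = -adjMatrix G i.1 j.1 := by
  rw [auxLaplacian, Matrix.of_apply, if_neg hij,
    laplacian_apply_of_ne fun h => hij (Subtype.ext h)]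

theorem auxLaplacian_root (hloop : ∀ i, ¬ G.Adj i i) :
    P.auxLaplacian K = Matrix.diagonal (fun i => ∑ j, P.rootMatrix i j) - P.rootMatrix := by
  ext i j
  rw [Matrix.sub_apply, rootMatrix_apply]
  by_cases hij : i = j
  · subst hij
    rw [auxLaplacian, Matrix.of_apply, if_pos rfl, Matrix.diagonal_apply_eq,
      adjMatrix_self hloop, sub_zero, ← Finset.sum_neg_distrib,
      ← Finset.sum_erase Finset.univ (a := i) (adjMatrix_self hloop i.1)]
    refine Finset.sum_congr rfl fun p hp => ?_
    have hne : i.1 ≠ p.1 := fun h => (Finset.ne_of_mem_erase hp) (Subtype.ext h.symm)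
    rw [laplacian_apply_of_ne hne, neg_neg, rootMatrix_apply]
  · rw [P.auxLaplacian_apply_of_ne hij, Matrix.diagonal_apply_ne _ hij, zero_sub]

theorem isNormalizedLeftEigenvector_iff (hloop : ∀ i, ¬ G.Adj i i) (ξ : P.Block K → ℝ) :
    P.IsNormalizedLeftEigenvector ξ ↔ IsBalanced P.rootMatrix ξ ∧ ∑ i, ξ i = 1 := by
  rw [IsNormalizedLeftEigenvector, P.auxLaplacian_root hloop, ← isBalanced_iff_vecMul_eq_zero]

/-- The two sums in the trigger together run over all neighbours of the agent, since it has no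
neighbours in components of smaller number. -/
theorem qInner_add_qOuter {k : ℕ} (i : P.Block k) (y : V → ℝ) :
    P.qInner k i y + P.qOuter k i y = disagreement (adjMatrix G) y i.1 := by
  have hfib : ∀ p, ∑ j : P.Block p, adjMatrix G i.1 j.1 * (y i.1 - y j.1) ^ 2 =
      ∑ j ∈ Finset.univ.filter (fun j => P.blk j = p), adjMatrix G i.1 j * (y i.1 - y j) ^ 2 :=
    fun p => (Finset.sum_subtype _ (by simp)
      (fun j => adjMatrix G i.1 j * (y i.1 - y j) ^ 2)).symm
  have hin : P.qInner k i y = ∑ j : P.Block k, adjMatrix G i.1 j.1 * (y i.1 - y j.1) ^ 2 := by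
    rw [qInner, ← Finset.sum_neg_distrib]
    refine Finset.sum_congr rfl fun j _ => ?_
    by_cases hij : i = j
    · subst hij; simp
    · rw [P.auxLaplacian_apply_of_ne hij]; ring
  have hout : P.qOuter k i y = ∑ p ∈ Finset.Icc (k + 1) K, ∑ j : P.Block p,
      adjMatrix G i.1 j.1 * (y i.1 - y j.1) ^ 2 := by
    rw [qOuter, ← Finset.sum_neg_distrib]
    refine Finset.sum_congr rfl fun p hp => ?_
    rw [← Finset.sum_neg_distrib]
    refine Finset.sum_congr rfl fun j _ => ?_
    have hne : i.1 ≠ j.1 := by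
      intro h
      have h1 := i.2
      have h2 := j.2
      rw [h] at h1
      have := (Finset.mem_Icc.1 hp).1
      omega
    rw [laplacian_apply_of_ne hne]; ring
  have hk : k ≤ K := i.2 ▸ P.blk_le i.1
  have hIcc : ∑ p ∈ Finset.Icc k K, ∑ j : P.Block p,
      adjMatrix G i.1 j.1 * (y i.1 - y j.1) ^ 2 = P.qInner k i y + P.qOuter k i y := by
    rw [hin, hout, ← Finset.insert_Icc_add_one_left_eq_Icc hk, Finset.sum_insert (by simp)]
  rw [← hIcc, disagreement]
  simp only [hfib]
  rw [Finset.sum_fiberwise_eq_sum_filter]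
  refine Finset.sum_subset (Finset.subset_univ _) fun j _ hj => ?_
  have hlt : P.blk j < P.blk i.1 := by
    by_contra hle
    refine hj ?_
    simpa using ⟨i.2 ▸ not_lt.1 hle, P.blk_le j⟩
  rw [P.adjMatrix_eq_zero hlt, zero_mul]

end PerronFrobeniusForm

end Graph

/-! ### The closed loop at the sampling instants -/

namespace IsClosedLoop

variable {V : Type*} [Fintype V] [DecidableEq V] {G : Digraph V} [DecidableRel G.Adj] {K : ℕ}
  {P : PerronFrobeniusForm G K} {h : ℝ} {δ σ : V → ℝ} {x xh : V → ℝ → ℝ} {T : V → Set ℝ}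

theorem held_eq_of_mem (hx : IsClosedLoop P h δ σ x xh T) {i : V} {s : ℝ} (hs : s ∈ T i) :
    xh i s = x i s :=
  hx.hold i s hs s le_rfl fun _ _ hr => absurd hr.1 (not_lt.2 hr.2)

theorem held_eq_of_no_event (hx : IsClosedLoop P h δ σ x xh T) (hh : 0 < h) (i : V) (m : ℕ)
    {t : ℝ} (hmt : m * h ≤ t) (hno : ∀ r ∈ T i, ¬ (m * h < r ∧ r ≤ t)) :
    xh i t = xh i (m * h) := by
  classical
  let p : ℕ → Prop := fun k => (k : ℝ) * h ∈ T i
  have hp0 : p 0 := by simpa [p] using hx.zero_mem i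
  -- The latest event up to `m h` is also the latest event up to `t`.
  set k := Nat.findGreatest p m
  have hk : p k := Nat.findGreatest_spec (Nat.zero_le m) hp0
  have hkm : (k : ℝ) * h ≤ m * h :=
    mul_le_mul_of_nonneg_right (by exact_mod_cast Nat.findGreatest_le m) hh.le
  have hlatest : ∀ r ∈ T i, r ≤ m * h → ¬ (k : ℝ) * h < r := by
    intro r hr hrm hkr
    obtain ⟨l, rfl⟩ := hx.sampled i r hr
    have hkl : k < l := by exact_mod_cast lt_of_mul_lt_mul_right hkr hh.le
    have hlm : l ≤ m := by exact_mod_cast le_of_mul_le_mul_right hrm hh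
    exact Nat.findGreatest_is_greatest hkl hlm hr
  rw [hx.hold i _ hk t (hkm.trans hmt) fun r hr hkr =>
      hlatest r hr (not_lt.1 fun hmr => hno r hr ⟨hmr, hkr.2⟩) hkr.1,
    hx.hold i _ hk (m * h) hkm fun r hr hkr => hlatest r hr hkr.2 hkr.1]

/-- Between two sampling instants there is no event, so that the held value is constant. -/
theorem held_eq (hx : IsClosedLoop P h δ σ x xh T) (hh : 0 < h) (i : V) (m : ℕ) {t : ℝ}
    (h1 : m * h ≤ t) (h2 : t < ((m : ℝ) + 1) * h) : xh i t = xh i (m * h) := by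
  refine hx.held_eq_of_no_event hh i m h1 fun r hr hmr => ?_
  obtain ⟨l, rfl⟩ := hx.sampled i r hr
  have hml : m < l := by exact_mod_cast lt_of_mul_lt_mul_right hmr.1 hh.le
  have hlm : l < m + 1 := by
    exact_mod_cast lt_of_mul_lt_mul_right (hmr.2.trans_lt h2) hh.le
  omega

theorem held_succ (hx : IsClosedLoop P h δ σ x xh T) (hh : 0 < h) (i : V) (m : ℕ)
    (hm : ((m : ℝ) + 1) * h ∉ T i) : xh i (((m : ℝ) + 1) * h) = xh i (m * h) := by
  refine hx.held_eq_of_no_event hh i m (by linarith) fun r hr hmr => ?_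
  obtain ⟨l, rfl⟩ := hx.sampled i r hr
  have hml : m < l := by exact_mod_cast lt_of_mul_lt_mul_right hmr.1 hh.le
  have hlm : l ≤ m + 1 := by exact_mod_cast le_of_mul_le_mul_right hmr.2 hh
  obtain rfl : l = m + 1 := by omega
  exact hm (by exact_mod_cast hr)

/-- On a sampling interval, closed at both ends, the state is affine in time. -/
theorem state_eq (hx : IsClosedLoop P h δ σ x xh T) (hh : 0 < h) (i : V) (m : ℕ) {t : ℝ}
    (h1 : m * h ≤ t) (h2 : t ≤ ((m : ℝ) + 1) * h) :
    x i t = x i (m * h) + (t - m * h) * control G h δ (fun j => xh j (m * h)) i := by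
  set u := control G h δ (fun j => xh j (m * h)) i
  have h0 : 0 ≤ (m : ℝ) * h := mul_nonneg m.cast_nonneg hh.le
  have key := constant_of_has_deriv_right_zero (a := (m : ℝ) * h) (b := ((m : ℝ) + 1) * h)
    (f := fun t => x i t - (t - m * h) * u) ?_ ?_ t ⟨h1, h2⟩
  · simp only [sub_self, zero_mul, sub_zero] at key
    linarith
  · refine ContinuousOn.sub ((hx.continuous i).mono fun s hs => h0.trans hs.1) ?_
    fun_prop
  · intro s hs
    have hd := hx.dynamics i s (h0.trans hs.1)
    have hc : control G h δ (fun j => xh j s) i = u := by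
      congr 1
      ext j
      exact hx.held_eq hh j m hs.1 hs.2
    rw [hc] at hd
    have hl : HasDerivWithinAt (fun t : ℝ => (t - m * h) * u) (1 * u) (Set.Ici s) s :=
      ((hasDerivWithinAt_id s _).sub_const _).mul_const u
    have := hd.sub hl
    rw [one_mul, sub_self] at this
    exact this

theorem state_succ (hx : IsClosedLoop P h δ σ x xh T) (hh : 0 < h) (i : V) (m : ℕ) :
    x i (((m : ℝ) + 1) * h) =
      x i (m * h) + h * control G h δ (fun j => xh j (m * h)) i := by
  rw [hx.state_eq hh i m (by linarith) le_rfl]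
  ring

theorem state_succ_of_inDegree_pos (hx : IsClosedLoop P h δ σ x xh T) (hh : 0 < h) {i : V}
    (hd : 0 < inDegree G i) (m : ℕ) :
    x i (((m : ℝ) + 1) * h) = x i (m * h) -
      δ i / inDegree G i * ∑ j, adjMatrix G i j * (xh i (m * h) - xh j (m * h)) := by
  rw [hx.state_succ hh, control, if_neg hd.ne']
  field_simp
  ring

/-- The trigger bounds the error: after an event it vanishes, and without an event it is below
the threshold. -/
theorem error_le (hx : IsClosedLoop P h δ σ x xh T) (hh : 0 < h) {i : V} (hσ : 0 < σ i)
    (hd : 0 < inDegree G i) (m : ℕ) :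
    4 * inDegree G i * (x i (((m : ℝ) + 1) * h) - xh i (((m : ℝ) + 1) * h)) ^ 2 ≤
      σ i * disagreement (adjMatrix G) (fun j => xh j (m * h)) i := by
  by_cases hm : ((m : ℝ) + 1) * h ∈ T i
  · rw [hx.held_eq_of_mem hm, sub_self]
    have := disagreement_nonneg (A := adjMatrix G) adjMatrix_nonneg (fun j => xh j (m * h)) i
    simpa using mul_nonneg hσ.le this
  · have ht := (hx.trigger (P.blk i) ⟨i, rfl⟩ hd.ne' m).not.1 hm
    rw [P.qInner_add_qOuter] at ht
    rw [hx.held_succ hh i m hm]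
    set e := (x i (((m : ℝ) + 1) * h) - xh i (m * h)) ^ 2
    set q := disagreement (adjMatrix G) (fun j => xh j (m * h)) i
    have hle : e ≤ σ i * (1 / (4 * inDegree G i)) * q := by linarith
    calc 4 * inDegree G i * e ≤ 4 * inDegree G i * (σ i * (1 / (4 * inDegree G i)) * q) :=
          mul_le_mul_of_nonneg_left hle (by linarith)
      _ = σ i * q := by field_simp

theorem state_eq_initial (hx : IsClosedLoop P h δ σ x xh T) (hh : 0 < h) {i : V}
    (hd : inDegree G i = 0) (m : ℕ) : x i (m * h) = x i 0 := by
  induction m with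
  | zero => simp
  | succ m ih =>
    rw [Nat.cast_succ, hx.state_succ hh, control, if_pos hd, ih]
    ring

theorem held_eq_initial (hx : IsClosedLoop P h δ σ x xh T) (hh : 0 < h) {i : V}
    (hd : inDegree G i = 0) (m : ℕ) : xh i (m * h) = x i 0 := by
  induction m with
  | zero => simpa using hx.held_eq_of_mem (hx.zero_mem i)
  | succ m ih =>
    rw [Nat.cast_succ]
    by_cases hm : ((m : ℝ) + 1) * h ∈ T i
    · rw [hx.held_eq_of_mem hm]
      simpa using hx.state_eq_initial hh hd (m + 1)
    · rw [hx.held_succ hh i m hm, ih]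

/-- Affine interpolation carries convergence at the sampling instants over to all times. -/
theorem tendsto_of_sampled (hx : IsClosedLoop P h δ σ x xh T) (hh : 0 < h) {i : V} {c : ℝ}
    (hc : Tendsto (fun m : ℕ => x i (m * h)) atTop (𝓝 c)) : Tendsto (x i) atTop (𝓝 c) := by
  have hfl : Tendsto (fun t : ℝ => ⌊t / h⌋₊) atTop atTop :=
    tendsto_nat_floor_atTop.comp (tendsto_id.atTop_div_const hh)
  have habs : Tendsto (fun m : ℕ => |x i (m * h) - c|) atTop (𝓝 0) := by
    have := (hc.sub_const c).abs
    simpa using this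
  have hsum := (habs.add ((tendsto_add_atTop_iff_nat 1).2 habs)).comp hfl
  rw [add_zero] at hsum
  rw [tendsto_iff_norm_sub_tendsto_zero]
  refine squeeze_zero' (Eventually.of_forall fun t => norm_nonneg _) ?_ hsum
  filter_upwards [eventually_ge_atTop (0 : ℝ)] with t ht
  set m := ⌊t / h⌋₊
  have h1 : (m : ℝ) * h ≤ t := (le_div_iff₀ hh).1 (Nat.floor_le (div_nonneg ht hh.le))
  have h2 : t ≤ ((m : ℝ) + 1) * h := ((div_lt_iff₀ hh).1 (Nat.lt_floor_add_one _)).le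
  have hs := hx.state_succ hh i m
  have ht' := hx.state_eq hh i m h1 h2
  set u := control G h δ (fun j => xh j (m * h)) i
  simp only [Function.comp_apply, Nat.cast_succ, Real.norm_eq_abs]
  -- The state is a convex combination of the states at the ends of the sampling interval.
  set θ := (t - m * h) / h
  have hθ0 : 0 ≤ θ := div_nonneg (by linarith) hh.le
  have hθ1 : θ ≤ 1 := (div_le_one hh).2 (by linarith)
  have hθ : t - m * h = θ * h := (div_mul_cancel₀ _ hh.ne').symm
  have hconv : x i t - c =
      (1 - θ) * (x i (m * h) - c) + θ * (x i (((m : ℝ) + 1) * h) - c) := by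
    rw [ht', hs, hθ]; ring
  rw [hconv]
  refine (abs_add_le _ _).trans (add_le_add ?_ ?_)
  · rw [abs_mul, abs_of_nonneg (by linarith : 0 ≤ 1 - θ)]
    exact mul_le_of_le_one_left (abs_nonneg _) (by linarith)
  · rw [abs_mul, abs_of_nonneg hθ0]
    exact mul_le_of_le_one_left (abs_nonneg _) hθ1

end IsClosedLoop

/-! ### Consensus -/

section Weights

variable {V : Type*} [Fintype V] [DecidableEq V] {G : Digraph V} [DecidableRel G.Adj] {K : ℕ}
  (P : PerronFrobeniusForm G K) {δ : V → ℝ} {ξ : P.Block K → ℝ}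

namespace PerronFrobeniusForm

theorem rootWeight_numerator_pos (hδ : ∀ i, 0 < δ i) (hξ : ∀ i, 0 < ξ i)
    (hcard : Fintype.card (P.Block K) ≠ 1) (i : P.Block K) :
    0 < (δ i.1)⁻¹ * inDegree G i.1 * ξ i :=
  mul_pos (mul_pos (inv_pos.2 (hδ i.1)) (P.inDegree_root_pos hcard i)) (hξ i)

theorem rootWeight_pos (hδ : ∀ i, 0 < δ i) (hξ : ∀ i, 0 < ξ i) (i : P.Block K) :
    0 < P.rootWeight δ ξ i := by
  rw [rootWeight]
  split_ifs with hcard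
  · exact one_pos
  · have hpos := P.rootWeight_numerator_pos hδ hξ hcard
    exact div_pos (hpos i) (Finset.sum_pos (fun j _ => hpos j) ⟨i, Finset.mem_univ i⟩)

theorem sum_rootWeight [Nonempty (P.Block K)] (hδ : ∀ i, 0 < δ i) (hξ : ∀ i, 0 < ξ i) :
    ∑ i, P.rootWeight δ ξ i = 1 := by
  by_cases hcard : Fintype.card (P.Block K) = 1
  · simp [rootWeight, hcard]
  · simp only [rootWeight, if_neg hcard]
    rw [← Finset.sum_div]
    exact div_self (Finset.sum_pos (fun j _ => P.rootWeight_numerator_pos hδ hξ hcard j)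
      Finset.univ_nonempty).ne'

/-- The adjacency matrix with an edge added from every agent of the last component to every
other agent, which makes the graph strongly connected if it has a spanning tree. Its balanced
weights are superharmonic for the original graph outside the last component. -/
def augmentedMatrix : Matrix V V ℝ :=
  Matrix.of fun i j => adjMatrix G i j + if P.blk i = K ∧ P.blk j ≠ K then 1 else 0

theorem augmentedMatrix_apply (i j : V) : P.augmentedMatrix i j =
    adjMatrix G i j + if P.blk i = K ∧ P.blk j ≠ K then 1 else 0 := rfl

theorem adjMatrix_le_augmentedMatrix (i j : V) : adjMatrix G i j ≤ P.augmentedMatrix i j := by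
  rw [augmentedMatrix_apply]
  split_ifs <;> simp

theorem augmentedMatrix_nonneg (i j : V) : 0 ≤ P.augmentedMatrix i j :=
  (adjMatrix_nonneg i j).trans (P.adjMatrix_le_augmentedMatrix i j)

theorem isStronglyConnected_augmentedMatrix (htree : HasSpanningTree G) :
    IsStronglyConnected P.augmentedMatrix := by
  obtain ⟨r, hr, hpath⟩ := P.exists_root htree
  have hmono : ∀ {i j}, Relation.ReflTransGen G.Adj i j →
      Relation.ReflTransGen (fun i j => 0 < P.augmentedMatrix i j) i j := fun h =>
    h.lift id fun i j hij =>
      (adjMatrix_pos_iff.2 hij).trans_le (P.adjMatrix_le_augmentedMatrix i j)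
  intro i j
  refine (hmono (hpath i)).trans ?_
  by_cases hj : P.blk j = K
  · exact hmono ((P.blk_eq_iff r j).1 (hr.trans hj.symm)).2
  · refine .single ?_
    rw [augmentedMatrix_apply, if_pos ⟨hr, hj⟩]
    linarith [adjMatrix_nonneg (G := G) r j]

end PerronFrobeniusForm

end Weights

namespace IsClosedLoop

variable {V : Type*} [Fintype V] [DecidableEq V] {G : Digraph V} [DecidableRel G.Adj] {K : ℕ}
  {P : PerronFrobeniusForm G K} {h : ℝ} {δ σ : V → ℝ} {x xh : V → ℝ → ℝ} {T : V → Set ℝ}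

theorem sqSummable_error (hx : IsClosedLoop P h δ σ x xh T) (hh : 0 < h) {i : V}
    (hσ : 0 < σ i) (hd : 0 < inDegree G i)
    (hq : Summable fun m : ℕ => disagreement (adjMatrix G) (fun j => xh j (m * h)) i) :
    SqSummable fun m : ℕ => x i (m * h) - xh i (m * h) := by
  refine (summable_nat_add_iff 1).1 ?_
  refine (summable_mul_left_iff (by linarith : 0 < 4 * inDegree G i).ne').1
    (Summable.of_nonneg_of_le (fun m => by positivity) (fun m => ?_) (hq.mul_left (σ i)))
  simpa only [Nat.cast_succ] using hx.error_le hh hσ hd m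

/-- The weighted average of the last component is invariant, as its edge differences are
weighted by balanced weights. -/
theorem sum_rootWeight_mul_state (hx : IsClosedLoop P h δ σ x xh T) (hh : 0 < h)
    (hδ : ∀ i, 0 < δ i) {ξ : P.Block K → ℝ} (hξ : IsBalanced P.rootMatrix ξ)
    (hcard : Fintype.card (P.Block K) ≠ 1) (m : ℕ) :
    ∑ i, P.rootWeight δ ξ i * x i.1 (m * h) = ∑ i, P.rootWeight δ ξ i * x i.1 0 := by
  induction m with
  | zero => simp
  | succ m ih =>
    rw [← ih, Nat.cast_succ]
    set Z := ∑ j : P.Block K, (δ j.1)⁻¹ * inDegree G j.1 * ξ j with hZ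
    have hterm : ∀ i : P.Block K, P.rootWeight δ ξ i * x i.1 (((m : ℝ) + 1) * h) =
        P.rootWeight δ ξ i * x i.1 (m * h) + Z⁻¹ * (ξ i *
          ∑ j, P.rootMatrix i j * (xh j.1 (m * h) - xh i.1 (m * h))) := by
      intro i
      have hd := P.inDegree_root_pos hcard i
      have hδi := hδ i.1
      rw [hx.state_succ_of_inDegree_pos hh hd,
        P.sum_rootMatrix_mul i fun j => xh j (m * h) - xh i.1 (m * h)]
      have hneg : ∑ j, adjMatrix G i.1 j * (xh j (m * h) - xh i.1 (m * h)) =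
          -∑ j, adjMatrix G i.1 j * (xh i.1 (m * h) - xh j (m * h)) := by
        rw [← Finset.sum_neg_distrib]
        exact Finset.sum_congr rfl fun j _ => by ring
      rw [hneg, PerronFrobeniusForm.rootWeight, if_neg hcard, ← hZ, div_eq_mul_inv]
      field_simp
      ring
    rw [Finset.sum_congr rfl fun i _ => hterm i, Finset.sum_add_distrib, ← Finset.mul_sum,
      hξ.sum_mul_sum_sub fun i => xh i.1 (m * h), mul_zero, add_zero]

/-- In the last component the residual of the energy estimate vanishes for the balanced weights
`ξ`. The held values therefore agree up to square-summable terms, and so they also agree with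
the invariant weighted average. -/
theorem sqSummable_held_root (hx : IsClosedLoop P h δ σ x xh T) (hh : 0 < h)
    (hloop : ∀ i, ¬ G.Adj i i)
    (hδ : ∀ i, 0 < δ i ∧ δ i < 1 / 2) (hσ : ∀ i, 0 < σ i ∧ σ i < 1 - 2 * δ i)
    {ξ : P.Block K → ℝ} (hξ : IsBalanced P.rootMatrix ξ) (hpos : ∀ i, 0 < ξ i)
    (i : P.Block K) :
    SqSummable fun m : ℕ =>
      xh i.1 (m * h) - ∑ j : P.Block K, P.rootWeight δ ξ j * x j.1 0 := by
  by_cases hcard : Fintype.card (P.Block K) = 1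
  · have : Subsingleton (P.Block K) := Fintype.card_le_one_iff_subsingleton.1 hcard.le
    have hc : ∑ j : P.Block K, P.rootWeight δ ξ j * x j.1 0 = x i.1 0 := by
      rw [Fintype.sum_subsingleton _ i, PerronFrobeniusForm.rootWeight, if_pos hcard, one_mul]
    rw [hc]
    simp [SqSummable, hx.held_eq_initial hh (P.inDegree_root_eq_zero hloop hcard i)]
  · have hA : ∀ i j, 0 ≤ P.rootMatrix i j := fun i j => adjMatrix_nonneg i.1 j.1
    have hd : ∀ i : P.Block K, 0 < inDegree G i.1 := P.inDegree_root_pos hcard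
    have hq : ∀ i ∈ (Finset.univ : Finset (P.Block K)), Summable fun m : ℕ =>
        disagreement P.rootMatrix (fun j => xh j.1 (m * h)) i := by
      refine summable_disagreement hA Finset.univ (δ := fun i => δ i.1) (σ := fun i => σ i.1)
        (ξ := ξ) (x := fun m i => x i.1 (m * h)) (y := fun m i => xh i.1 (m * h))
        (fun i _ => by rw [P.sum_rootMatrix]; exact hd i) (fun i => hδ i.1) (fun i => hσ i.1)
        (fun i _ => hpos i) ?_ ?_ 0 (summable_zero : Summable fun _ : ℕ => (0 : ℝ)) ?_
      · intro m i _
        rw [Nat.cast_succ, P.sum_rootMatrix,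
          P.sum_rootMatrix_mul i fun j => xh i.1 (m * h) - xh j (m * h)]
        exact hx.state_succ_of_inDegree_pos hh (hd i) m
      · intro m i _
        rw [Nat.cast_succ, P.sum_rootMatrix,
          P.disagreement_rootMatrix (fun j => xh j (m * h)) i]
        exact hx.error_le hh (hσ i.1).1 (hd i) m
      · exact fun m => (hξ.sum_mul_sum_sub fun i => (xh i.1 (m * h) - 0) ^ 2).le
    have herr : ∀ j : P.Block K, SqSummable fun m : ℕ => x j.1 (m * h) - xh j.1 (m * h) := by
      refine fun j => hx.sqSummable_error hh (hσ j.1).1 (hd j) ?_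
      exact (hq j (Finset.mem_univ j)).congr fun m =>
        P.disagreement_rootMatrix (fun j => xh j (m * h)) j
    have hdiff : ∀ j : P.Block K,
        SqSummable fun m : ℕ => xh i.1 (m * h) - xh j.1 (m * h) := by
      intro j
      induction P.isStronglyConnected_rootMatrix i j with
      | refl => simp [SqSummable]
      | @tail b c _ hbc ih =>
        have := ih.add (sqSummable_sub_of_summable_disagreement hA
          (y := fun m i => xh i.1 (m * h)) hbc (hq b (Finset.mem_univ b)))
        simpa using this
    have hsum := SqSummable.sum Finset.univ fun (j : P.Block K) _ =>
      ((hdiff j).add ((herr j).const_mul (-1))).const_mul (P.rootWeight δ ξ j)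
    have : Nonempty (P.Block K) := ⟨i⟩
    have h1 := P.sum_rootWeight (fun i => (hδ i).1) hpos
    convert hsum using 2 with m
    have hi : xh i.1 (m * h) = ∑ j, P.rootWeight δ ξ j * xh i.1 (m * h) := by
      rw [← Finset.sum_mul, h1, one_mul]
    rw [← hx.sum_rootWeight_mul_state hh (fun i => (hδ i).1) hξ hcard m]
    refine (congrArg (· - _) hi).trans ?_
    rw [← Finset.sum_sub_distrib]
    exact Finset.sum_congr rfl fun j _ => by ring

/-- Outside the last component, the balanced weights of the augmented matrix leave a residual
that involves only the last component, where the deviation from `c` is square-summable. -/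
theorem summable_disagreement_of_blk_ne (hx : IsClosedLoop P h δ σ x xh T) (hh : 0 < h)
    (htree : HasSpanningTree G)
    (hδ : ∀ i, 0 < δ i ∧ δ i < 1 / 2) (hσ : ∀ i, 0 < σ i ∧ σ i < 1 - 2 * δ i) {c : ℝ}
    (hroot : ∀ i, P.blk i = K → SqSummable fun m : ℕ => xh i (m * h) - c)
    {i : V} (hi : P.blk i ≠ K) :
    Summable fun m : ℕ => disagreement (adjMatrix G) (fun j => xh j (m * h)) i := by
  have hA := P.augmentedMatrix_nonneg
  have hirr := P.isStronglyConnected_augmentedMatrix htree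
  have : Nonempty V := ⟨i⟩
  obtain ⟨ζ, ⟨hζ, hζ1⟩, _⟩ := existsUnique_isBalanced hA hirr
  have hpos : ∀ i, 0 < ζ i := hζ.pos_of_sum_pos hA hirr (hζ1 ▸ one_pos)
  have hd : ∀ i, P.blk i ≠ K → 0 < inDegree G i := by
    intro i hi
    obtain ⟨r, hr, hpath⟩ := P.exists_root htree
    rcases Relation.ReflTransGen.cases_head (hpath i) with rfl | ⟨b, hb, _⟩
    · exact absurd hr hi
    · exact inDegree_pos_of_adj hb
  set S : Finset V := Finset.univ.filter fun i => P.blk i ≠ K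
  have hS : ∀ {i}, i ∈ S ↔ P.blk i ≠ K := by simp [S]
  set R : Finset V := Finset.univ.filter fun i => ¬ P.blk i ≠ K
  refine summable_disagreement (adjMatrix_nonneg (G := G)) S (fun i hi => hd i (hS.1 hi)) hδ hσ
    (fun i _ => hpos i) (x := fun m i => x i (m * h)) (y := fun m i => xh i (m * h))
    (f := fun m => ∑ i ∈ R, ζ i * (∑ j, P.augmentedMatrix i j) * (xh i (m * h) - c) ^ 2)
    ?_ ?_ c ?_ ?_ i (hS.2 hi)
  · intro m i hi
    rw [Nat.cast_succ]
    exact hx.state_succ_of_inDegree_pos hh (hd i (hS.1 hi)) m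
  · intro m i hi
    rw [Nat.cast_succ]
    exact hx.error_le hh (hσ i).1 (hd i (hS.1 hi)) m
  · refine summable_sum fun i hi => (hroot i ?_).mul_left _
    simpa [R] using hi
  · intro m
    set g : V → ℝ := fun i => (xh i (m * h) - c) ^ 2
    -- The balance over all agents turns the sum over `S` into minus the sum over `R`.
    have hbal := hζ.sum_mul_sum_sub g
    rw [← Finset.sum_filter_add_sum_filter_not Finset.univ fun i => P.blk i ≠ K] at hbal
    -- No added edge starts in `S`.
    have hSsum : ∑ i ∈ S, ζ i * ∑ j, adjMatrix G i j * (g j - g i) =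
        ∑ i ∈ S, ζ i * ∑ j, P.augmentedMatrix i j * (g j - g i) := by
      refine Finset.sum_congr rfl fun i hi => ?_
      simp [PerronFrobeniusForm.augmentedMatrix_apply, hS.1 hi]
    have hRsum : -∑ i ∈ R, ζ i * (∑ j, P.augmentedMatrix i j) * g i ≤
        ∑ i ∈ R, ζ i * ∑ j, P.augmentedMatrix i j * (g j - g i) := by
      rw [← Finset.sum_neg_distrib]
      refine Finset.sum_le_sum fun i _ => ?_
      rw [mul_assoc, ← mul_neg]
      refine mul_le_mul_of_nonneg_left ?_ (hpos i).le
      rw [Finset.sum_mul, ← Finset.sum_neg_distrib]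
      refine Finset.sum_le_sum fun j _ => ?_
      have := mul_nonneg (hA i j) (sq_nonneg (xh j (m * h) - c))
      simp only [g]
      linarith
    change ∑ i ∈ S, ζ i * ∑ j, adjMatrix G i j * (g j - g i) ≤
      ∑ i ∈ R, ζ i * (∑ j, P.augmentedMatrix i j) * g i
    rw [hSsum]
    linarith

/-- Square-summability propagates along a path to the last component. -/
theorem sqSummable_held (hx : IsClosedLoop P h δ σ x xh T) (hh : 0 < h)
    (htree : HasSpanningTree G)
    (hδ : ∀ i, 0 < δ i ∧ δ i < 1 / 2) (hσ : ∀ i, 0 < σ i ∧ σ i < 1 - 2 * δ i) {c : ℝ}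
    (hroot : ∀ i, P.blk i = K → SqSummable fun m : ℕ => xh i (m * h) - c) (i : V) :
    SqSummable fun m : ℕ => xh i (m * h) - c := by
  obtain ⟨r, hr, hpath⟩ := P.exists_root htree
  have hp : Relation.ReflTransGen G.Adj i r := hpath i
  induction hp using Relation.ReflTransGen.head_induction_on with
  | refl => exact hroot r hr
  | @head a b hab _ ih =>
    by_cases ha : P.blk a = K
    · exact hroot a ha
    · have hq := hx.summable_disagreement_of_blk_ne hh htree hδ hσ hroot ha
      have := (sqSummable_sub_of_summable_disagreement adjMatrix_nonneg
        (y := fun m i => xh i (m * h)) (adjMatrix_pos_iff.2 hab) hq).add ih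
      simpa using this

theorem tendsto_state (hx : IsClosedLoop P h δ σ x xh T) (hh : 0 < h)
    (hσ : ∀ i, 0 < σ i) {c : ℝ}
    (hheld : ∀ i, SqSummable fun m : ℕ => xh i (m * h) - c) (i : V) :
    Tendsto (x i) atTop (𝓝 c) := by
  have herr : SqSummable fun m : ℕ => x i (m * h) - xh i (m * h) := by
    rcases (inDegree_nonneg (G := G) i).eq_or_lt with hd | hd
    · simp [SqSummable, hx.held_eq_initial hh hd.symm, hx.state_eq_initial hh hd.symm]
    · refine hx.sqSummable_error hh (hσ i) hd (summable_sum fun j _ => ?_)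
      have := (hheld i).add ((hheld j).const_mul (-1))
      refine Summable.mul_left _ (this.congr fun m => ?_)
      ring
  have hlim := (herr.add (hheld i)).tendsto_zero
  refine hx.tendsto_of_sampled hh (tendsto_sub_nhds_zero_iff.1 (hlim.congr fun m => ?_))
  ring

end IsClosedLoop

end EventConsensus

theorem theorem2 {V : Type*} [Fintype V] [DecidableEq V] (G : Digraph V) [DecidableRel G.Adj]
    (hloop : ∀ i, ¬ G.Adj i i) (htree : EventConsensus.HasSpanningTree G)
    (K : ℕ) (P : EventConsensus.PerronFrobeniusForm G K)
    (h : ℝ) (hh : 0 < h) (δ σ : V → ℝ)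
    (hδ : ∀ i, 0 < δ i ∧ δ i < 1 / 2) (hσ : ∀ i, 0 < σ i ∧ σ i < 1 - 2 * δ i)
    (x xh : V → ℝ → ℝ) (T : V → Set ℝ)
    (hx : EventConsensus.IsClosedLoop P h δ σ x xh T) :
    (∃! ξ : P.Block K → ℝ, P.IsNormalizedLeftEigenvector ξ) ∧
    ∀ ξ : P.Block K → ℝ, P.IsNormalizedLeftEigenvector ξ →
      (∀ i, 0 < P.rootWeight δ ξ i) ∧ ∑ i, P.rootWeight δ ξ i = 1 ∧
      ∀ v : V, Tendsto (x v) atTop (𝓝 (∑ i : P.Block K, P.rootWeight δ ξ i * x i.1 0)) := by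
  obtain ⟨r, hr, -⟩ := P.exists_root htree
  have : Nonempty (P.Block K) := ⟨⟨r, hr⟩⟩
  have hA : ∀ i j, 0 ≤ P.rootMatrix i j := fun i j => EventConsensus.adjMatrix_nonneg i.1 j.1
  have hirr := P.isStronglyConnected_rootMatrix
  simp only [P.isNormalizedLeftEigenvector_iff hloop]
  refine ⟨EventConsensus.existsUnique_isBalanced hA hirr, ?_⟩
  rintro ξ ⟨hξ, hξ1⟩
  have hpos := hξ.pos_of_sum_pos hA hirr (hξ1 ▸ one_pos)
  exact ⟨P.rootWeight_pos (fun i => (hδ i).1) hpos, P.sum_rootWeight (fun i => (hδ i).1) hpos,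
    hx.tendsto_state hh (fun i => (hσ i).1) (hx.sqSummable_held hh htree hδ hσ fun i hi =>
      hx.sqSummable_held_root hh hloop hδ hσ hξ hpos ⟨i, hi⟩)⟩
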